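/- All graphs are simple and undirected and may be infinite. A \emph{ray} in a graph $\Gamma$ is a one-way infinite path; two rays are equivalent if there are infinitely many pairwise vertex-disjoint paths between them in $\Gamma$, and an \emph{end} of $\Gamma$ is an equivalence class of rays. For a finite family $\mathcal R=(R_1,\dots,R_n)$ of pairwise vertex-disjoint rays in $\Gamma$, the \emph{ray graph} $RG(\mathcal R)$ has vertex set $\{1,\dots,n\}$, with distinct $i,j$ adjacent if and only if there is an infinite collection of pairwise vertex-disjoint $R_i$--$R_j$ paths in $\Gamma$ meeting no other $R_\ell$. A finite graph $F$ is \emph{$k$-pebble-win} if any $k$-tuple of distinct vertices of $F$ can be transformed into any other such $k$-tuple by finitely many moves, where a move replaces one entry of the tuple by an adjacent vertex of $F$ that is not in the tuple. An end $\omega$ of $\Gamma$ is \emph{pebbly} if for every $k\in\mathbb N$ there are $n\ge k$ and a family $\mathcal R=(R_1,\dots,R_n)$ of pairwise vertex-disjoint rays in $\omega$ such that $RG(\mathcal R)$ is $k$-pebble-win. A graph $G$ is a \emph{minor} of $\Gamma$, written $G\preceq\Gamma$, if there are a subgraph $H\subseteq\Gamma$ and a map $\varphi\colon V(H)\to V(G)$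 such that for every $v\in V(G)$ the set $\varphi^{-1}(v)$ induces a non-empty connected subgraph of $H$, and for all distinct $v,w\in V(G)$ there is an edge of $H$ between $\varphi^{-1}(v)$ and $\varphi^{-1}(w)$ if and only if $vw\in E(G)$, and this edge, if it exists, is unique. Let $\aleph_0 G$ denote the disjoint union of $\aleph_0$ many copies of $G$, and $K_{\aleph_0}$ the complete graph on a countably infinite vertex set. \textbf{Statement.} Let $\Gamma$ be a graph with a pebbly end. Then $K_{\aleph_0}\preceq\Gamma$. Consequently, $\aleph_0 G\preceq\Gamma$ for every countable graph $G$. -/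

import Mathlib

/-! ### Rays and ends -/

namespace PebblyEnds

variable {V : Type*} {W : Type*} {ι : Type*}

/-- A ray (one-way infinite path) in `Γ`, given by the sequence of its vertices, starting
with its initial vertex. -/
structure Ray (Γ : SimpleGraph V) where
  vert : ℕ → V
  inj : Function.Injective vert
  adj : ∀ n, Γ.Adj (vert n) (vert (n + 1))

/-- The vertex set of a ray. -/
def Ray.verts {Γ : SimpleGraph V} (R : Ray Γ) : Set V := Set.range R.vert

/-- An `A`-`B` path: a path whose first vertex is its only vertex in `A` and whose last vertex is
its only vertex in `B` (a single vertex of `A ∩ B` is allowed). -/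
structure IsPathBetween {Γ : SimpleGraph V} (A B : Set V) {a b : V} (p : Γ.Walk a b) : Prop where
  isPath : p.IsPath
  mem_left : ∀ v ∈ p.support, v ∈ A ↔ v = a
  mem_right : ∀ v ∈ p.support, v ∈ B ↔ v = b

/-- There is an infinite collection of pairwise vertex disjoint `A`-`B` paths in `Γ`, none of
which meets the vertex set `Z`. -/
def InfDisjointPaths (Γ : SimpleGraph V) (A B Z : Set V) : Prop :=
  ∃ (a b : ℕ → V) (P : ∀ n, Γ.Walk (a n) (b n)),
    (∀ n, IsPathBetween A B (P n)) ∧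
    (∀ n, ∀ v ∈ (P n).support, v ∉ Z) ∧
    Pairwise (fun m n => ∀ v ∈ (P m).support, v ∉ (P n).support)

/-- Two rays are equivalent if there are infinitely many vertex disjoint paths between them. -/
def RayEquiv {Γ : SimpleGraph V} (R S : Ray Γ) : Prop :=
  InfDisjointPaths Γ R.verts S.verts ∅

theorem InfDisjointPaths.symm {Γ : SimpleGraph V} {A B Z : Set V}
    (h : InfDisjointPaths Γ A B Z) : InfDisjointPaths Γ B A Z := by
  obtain ⟨a, b, P, h1, h2, h3⟩ := h
  refine ⟨b, a, fun n => (P n).reverse, fun n => ⟨(h1 n).isPath.reverse, ?_, ?_⟩, ?_, ?_⟩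
  · intro v hv
    exact (h1 n).mem_right v (by simpa using hv)
  · intro v hv
    exact (h1 n).mem_left v (by simpa using hv)
  · intro n v hv
    exact h2 n v (by simpa using hv)
  · intro m n hmn v hv hv'
    exact h3 hmn v (by simpa using hv) (by simpa using hv')

theorem RayEquiv.refl {Γ : SimpleGraph V} (R : Ray Γ) : RayEquiv R R := by
  refine ⟨R.vert, R.vert, fun _ => .nil, fun n => ⟨.nil, ?_, ?_⟩, ?_, ?_⟩
  · simp [Ray.verts]
  · simp [Ray.verts]
  · simp
  · intro m n hmn v hv hv'
    simp only [SimpleGraph.Walk.support_nil, List.mem_singleton] at hv hv'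
    exact hmn (R.inj (hv.symm.trans hv'))

/-- Infinitely many disjoint `A`-`B` paths exist as soon as no finite vertex set meets all
walks from `A` to `B`. -/
theorem infDisjointPaths_of_forall_finset {Γ : SimpleGraph V} {A B : Set V}
    (h : ∀ X : Finset V, ∃ a ∈ A, ∃ b ∈ B, ∃ p : Γ.Walk a b, ∀ v ∈ p.support, v ∉ X) :
    InfDisjointPaths Γ A B ∅ := by
  classical
  have key : ∀ X : Finset V, ∃ q : (Σ a b : V, Γ.Walk a b),
      IsPathBetween A B q.2.2 ∧ ∀ v ∈ q.2.2.support, v ∉ X := by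
    intro X
    have hex : ∃ n : ℕ, ∃ a ∈ A, ∃ b ∈ B, ∃ p : Γ.Walk a b,
        (∀ v ∈ p.support, v ∉ X) ∧ p.length = n := by
      obtain ⟨a, ha, b, hb, p, hp⟩ := h X
      exact ⟨_, a, ha, b, hb, p, hp, rfl⟩
    obtain ⟨a, ha, b, hb, p, hp, hl⟩ := Nat.find_spec hex
    have hmin : ∀ a' ∈ A, ∀ b' ∈ B, ∀ q : Γ.Walk a' b', (∀ v ∈ q.support, v ∉ X) →
        p.length ≤ q.length := by
      intro a' ha' b' hb' q hq
      rw [hl]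
      exact Nat.find_min' hex ⟨a', ha', b', hb', q, hq, rfl⟩
    refine ⟨⟨a, b, p⟩, ⟨?_, ?_, ?_⟩, hp⟩
    · have h1 := hmin a ha b hb p.bypass (fun v hv => hp v (p.support_bypass_subset_support hv))
      have h2 : p.bypass = p :=
        SimpleGraph.Walk.bypass_eq_self_of_length_le_length_bypass p h1
      rw [← h2]
      exact p.bypass_isPath
    · intro v hv
      refine ⟨fun hvA => ?_, fun e => e ▸ ha⟩
      have h1 := hmin v hvA b hb (p.dropUntil v hv)
        (fun w hw => hp w (p.support_dropUntil_subset_support hv hw))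
      have h2 := congrArg SimpleGraph.Walk.length (p.take_spec hv)
      rw [SimpleGraph.Walk.length_append] at h2
      have h3 : (p.takeUntil v hv).length = 0 := by omega
      exact (SimpleGraph.Walk.eq_of_length_eq_zero h3).symm
    · intro v hv
      refine ⟨fun hvB => ?_, fun e => e ▸ hb⟩
      have h1 := hmin a ha v hvB (p.takeUntil v hv)
        (fun w hw => hp w (p.support_takeUntil_subset_support hv hw))
      have h2 := congrArg SimpleGraph.Walk.length (p.take_spec hv)
      rw [SimpleGraph.Walk.length_append] at h2
      have h3 : (p.dropUntil v hv).length = 0 := by omega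
      exact SimpleGraph.Walk.eq_of_length_eq_zero h3
  choose q hq hqX using key
  let X : ℕ → Finset V := fun n => n.rec ∅ (fun _ Y => Y ∪ (q Y).2.2.support.toFinset)
  have hmono : Monotone X := monotone_nat_of_le_succ (fun n => Finset.subset_union_left)
  have hlt : ∀ m n, m < n → ∀ v ∈ (q (X m)).2.2.support, v ∉ (q (X n)).2.2.support := by
    intro m n hmn v hv hv'
    refine hqX (X n) v hv' (hmono (Nat.succ_le_of_lt hmn) ?_)
    exact Finset.mem_union_right _ (List.mem_toFinset.2 hv)
  refine ⟨fun n => (q (X n)).1, fun n => (q (X n)).2.1, fun n => (q (X n)).2.2,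
    fun n => hq _, by simp, ?_⟩
  intro m n hmn v hv hv'
  rcases lt_or_gt_of_ne hmn with h' | h'
  · exact hlt m n h' v hv hv'
  · exact hlt n m h' v hv' hv

/-- Among infinitely many disjoint paths one avoids a given finite vertex set. -/
theorem InfDisjointPaths.exists_avoiding {Γ : SimpleGraph V} {A B Z : Set V}
    (h : InfDisjointPaths Γ A B Z) (X : Finset V) :
    ∃ a ∈ A, ∃ b ∈ B, ∃ p : Γ.Walk a b, ∀ v ∈ p.support, v ∉ X := by
  obtain ⟨a, b, P, h1, -, h3⟩ := h
  by_contra hcon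
  have hall : ∀ n, ∃ v ∈ (P n).support, v ∈ X := by
    intro n
    by_contra hn
    refine hcon ⟨a n, ((h1 n).mem_left _ (P n).start_mem_support).2 rfl,
      b n, ((h1 n).mem_right _ (P n).end_mem_support).2 rfl, P n, ?_⟩
    intro v hv hvX
    exact hn ⟨v, hv, hvX⟩
  choose f hf hfX using hall
  have hinj : Function.Injective f := by
    intro m n hmn
    by_contra hne
    exact h3 hne (f m) (hf m) (hmn ▸ hf n)
  exact Set.infinite_of_injective_forall_mem hinj (s := (X : Set V)) hfX X.finite_toSet

theorem Ray.exists_segment {Γ : SimpleGraph V} (S : Ray Γ) (m d : ℕ) :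
    ∃ p : Γ.Walk (S.vert m) (S.vert (m + d)),
      ∀ v ∈ p.support, ∃ i, m ≤ i ∧ v = S.vert i := by
  induction d with
  | zero => exact ⟨.nil, fun v hv => ⟨m, le_rfl, by simpa using hv⟩⟩
  | succ d ih =>
    obtain ⟨p, hp⟩ := ih
    refine ⟨p.concat (S.adj (m + d)), fun v hv => ?_⟩
    rw [SimpleGraph.Walk.support_concat, List.mem_append] at hv
    rcases hv with hv | hv
    · exact hp v hv
    · exact ⟨m + (d + 1), by omega, List.mem_singleton.1 hv⟩

theorem RayEquiv.trans {Γ : SimpleGraph V} {R S T : Ray Γ}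
    (h₁ : RayEquiv R S) (h₂ : RayEquiv S T) : RayEquiv R T := by
  classical
  refine infDisjointPaths_of_forall_finset fun X => ?_
  have hfin : (S.vert ⁻¹' (X : Set V)).Finite := X.finite_toSet.preimage S.inj.injOn
  obtain ⟨N, hN⟩ := hfin.bddAbove
  let Y : Finset V := X ∪ (Finset.range (N + 1)).image S.vert
  have hY : ∀ i, S.vert i ∉ Y → ∀ j, i ≤ j → S.vert j ∉ X := by
    intro i hi j hij hj
    have hjN : j ≤ N := hN hj
    exact hi (Finset.mem_union_right _ (Finset.mem_image_of_mem _ (Finset.mem_range.2 (by omega))))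
  obtain ⟨a, ha, s, ⟨m, rfl⟩, p, hp⟩ := InfDisjointPaths.exists_avoiding h₁ Y
  obtain ⟨s', ⟨n, rfl⟩, b, hb, q, hq⟩ := InfDisjointPaths.exists_avoiding h₂ Y
  have hXY : ∀ v, v ∉ Y → v ∉ X := fun v hv hvX => hv (Finset.mem_union_left _ hvX)
  have hm := hp _ p.end_mem_support
  have hn := hq _ q.start_mem_support
  obtain ⟨c, hc⟩ : ∃ c : Γ.Walk (S.vert m) (S.vert n), ∀ v ∈ c.support, v ∉ X := by
    rcases le_total m n with hmn | hmn
    · obtain ⟨d, rfl⟩ := Nat.exists_eq_add_of_le hmn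
      obtain ⟨c, hc⟩ := S.exists_segment m d
      refine ⟨c, fun v hv => ?_⟩
      obtain ⟨i, hi, rfl⟩ := hc v hv
      exact hY m hm i hi
    · obtain ⟨d, rfl⟩ := Nat.exists_eq_add_of_le hmn
      obtain ⟨c, hc⟩ := S.exists_segment n d
      refine ⟨c.reverse, fun v hv => ?_⟩
      obtain ⟨i, hi, rfl⟩ := hc v (by simpa using hv)
      exact hY n hn i hi
  refine ⟨a, ha, b, hb, (p.append c).append q, fun v hv => ?_⟩
  rw [SimpleGraph.Walk.mem_support_append_iff, SimpleGraph.Walk.mem_support_append_iff] at hv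
  rcases hv with (hv | hv) | hv
  · exact hXY v (hp v hv)
  · exact hc v hv
  · exact hXY v (hq v hv)

/-- Equivalence of rays as a setoid. -/
def raySetoid (Γ : SimpleGraph V) : Setoid (Ray Γ) where
  r := RayEquiv
  iseqv := ⟨RayEquiv.refl, InfDisjointPaths.symm, RayEquiv.trans⟩

/-- The ends of `Γ`: equivalence classes of rays. -/
def GraphEnd (Γ : SimpleGraph V) : Type _ := Quotient (raySetoid Γ)

/-- The ray `R` belongs to the end `ω`. -/
def Ray.TendsTo {Γ : SimpleGraph V} (R : Ray Γ) (ω : GraphEnd Γ) : Prop :=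
  Quotient.mk (raySetoid Γ) R = ω

/-- The rays of the family are pairwise vertex disjoint. -/
def DisjointRays {Γ : SimpleGraph V} (R : ι → Ray Γ) : Prop :=
  Pairwise fun i j => Disjoint (R i).verts (R j).verts

/-- The ray graph of a family of rays: `i` and `j` are adjacent if there is an infinite
collection of vertex disjoint `R i`-`R j` paths in `Γ` that meet no other `R k`. -/
def rayGraph {Γ : SimpleGraph V} (R : ι → Ray Γ) : SimpleGraph ι where
  Adj i j := i ≠ j ∧
    InfDisjointPaths Γ (R i).verts (R j).verts {v | ∃ k, k ≠ i ∧ k ≠ j ∧ v ∈ (R k).verts}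
  symm := ⟨fun i j h => ⟨h.1.symm, by
    have h2 := h.2.symm
    rwa [show {v | ∃ k, k ≠ i ∧ k ≠ j ∧ v ∈ (R k).verts} =
      {v | ∃ k, k ≠ j ∧ k ≠ i ∧ v ∈ (R k).verts} by
        ext v
        exact exists_congr fun k => and_left_comm] at h2⟩⟩
  loopless := ⟨fun _ h => h.1 rfl⟩

/-! ### The pebble-pushing game -/

/-- A game state with `k` labelled pebbles: a `k`-tuple of distinct vertices. -/
abbrev GameState (W : Type*) (k : ℕ) := Fin k ↪ W

/-- `Z` arises from `Y` by moving one pebble to an adjacent vertex.  The target vertex is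
unoccupied because `Z` is again a game state. -/
def IsMove (G : SimpleGraph W) {k : ℕ} (Y Z : GameState W k) : Prop :=
  ∃ l : Fin k, G.Adj (Y l) (Z l) ∧ ∀ i, i ≠ l → Y i = Z i

/-- `Y` is achievable from `X` by a finite sequence of moves. -/
def Achievable (G : SimpleGraph W) {k : ℕ} (X Y : GameState W k) : Prop :=
  Relation.ReflTransGen (IsMove G) X Y

/-- `G` is `k`-pebble-win. -/
def PebbleWin (G : SimpleGraph W) (k : ℕ) : Prop :=
  ∀ X Y : GameState W k, Achievable G X Y

/-- The end `ω` is pebbly: for every `k` there are `n ≥ k` and `n` disjoint rays in `ω` whose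
ray graph is `k`-pebble-win. -/
def IsPebbly {Γ : SimpleGraph V} (ω : GraphEnd Γ) : Prop :=
  ∀ k : ℕ, ∃ n : ℕ, k ≤ n ∧ ∃ R : Fin n → Ray Γ,
    DisjointRays R ∧ (∀ i, (R i).TendsTo ω) ∧ PebbleWin (rayGraph R) k

/-! ### Minors -/

/-- `(H, φ)` is an inflated copy of `G`: the branch sets `φ ⁻¹' {v}` induce non-empty connected
subgraphs of `H`, and between the branch sets of distinct `v` and `w` there is an edge of `H` if
and only if `v` and `w` are adjacent in `G`, in which case the edge is unique. -/
structure IsInflatedCopy {U : Type*} (G : SimpleGraph W) (H : SimpleGraph U) (φ : U → W) :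
    Prop where
  connected : ∀ v, (H.induce (φ ⁻¹' {v})).Connected
  exists_edge_iff : ∀ v w, v ≠ w →
    ((∃ x y, φ x = v ∧ φ y = w ∧ H.Adj x y) ↔ G.Adj v w)
  edge_unique : ∀ v w, v ≠ w → ∀ x y x' y', φ x = v → φ y = w → H.Adj x y →
    φ x' = v → φ y' = w → H.Adj x' y' → x = x' ∧ y = y'

/-- `G` is a minor of `Γ`: some subgraph of `Γ` is an inflated copy of `G`. -/
def IsMinor (G : SimpleGraph W) (Γ : SimpleGraph V) : Prop :=
  ∃ (H : Γ.Subgraph) (φ : H.verts → W), IsInflatedCopy G H.coe φ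

/-- The disjoint union of countably infinitely many copies of `G`. -/
def alephZeroCopies (G : SimpleGraph W) : SimpleGraph (ℕ × W) where
  Adj x y := x.1 = y.1 ∧ G.Adj x.2 y.2
  symm := ⟨fun _ _ h => ⟨h.1.symm, h.2.symm⟩⟩
  loopless := ⟨fun _ h => G.irrefl h.2⟩

end PebblyEnds

/-! ### Menger's theorem -/

namespace SimpleGraph

variable {V : Type*}

/-! The clique is built as an increasing sequence of finite stages (`IsRootedClique`): finite,
connected, disjoint, pairwise adjacent sets, each the start of a ray of the pebbly end, the rays
being disjoint. Sets only grow, so adjacencies once created survive, and the unions over all stages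
are the branch sets of a complete minor. The rays are replaced at every stage.

One stage, from `k` to `k + 1` sets, is `IsRootedClique.exists_succ`. Take a family of rays of the
end whose ray graph is `(k + 1)`-pebble-win. Since all rays involved are equivalent, Menger's
theorem links the old sets disjointly to distinct rays of this family (`exists_linkage`), and a new
set is started on a ray that is still free. The sets now behave as pebbles: a move in the ray graph
is realised by growing one set through a far-out connecting path (`PebbleConfig.move`). Winning the
game brings the new set next to each old one in turn, where an edge between the two can be created
(`PebbleConfig.link`).

Menger's theorem is needed only inside a finite region, so it is proved for graphs with finitely
many edges, by induction on their number. -/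

/-- Every walk of `G` from `A` to `B` meets `X`. -/
def Separates (G : SimpleGraph V) (A B X : Set V) : Prop :=
  ∀ ⦃a⦄, a ∈ A → ∀ ⦃b⦄, b ∈ B → ∀ p : G.Walk a b, ∃ v ∈ p.support, v ∈ X

/-- Some walk of `G` from `A` to `v` avoids `X`. -/
def ReachAvoiding (G : SimpleGraph V) (A X : Set V) (v : V) : Prop :=
  ∃ a ∈ A, ∃ p : G.Walk a v, ∀ u ∈ p.support, u ∉ X

variable {G : SimpleGraph V} {A B X : Set V}

theorem Separates.symm (h : G.Separates A B X) : G.Separates B A X := by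
  intro b hb a ha p
  obtain ⟨v, hv, hvX⟩ := h ha hb p.reverse
  exact ⟨v, by simpa using hv, hvX⟩

theorem ReachAvoiding.of_mem {a : V} (ha : a ∈ A) (haX : a ∉ X) : G.ReachAvoiding A X a :=
  ⟨a, ha, .nil, by simpa using haX⟩

theorem ReachAvoiding.notMem {v : V} (h : G.ReachAvoiding A X v) : v ∉ X := by
  obtain ⟨a, -, p, hp⟩ := h
  exact hp v p.end_mem_support

theorem ReachAvoiding.adj {v w : V} (h : G.ReachAvoiding A X v) (hvw : G.Adj v w)
    (hw : w ∉ X) : G.ReachAvoiding A X w := by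
  obtain ⟨a, ha, p, hp⟩ := h
  refine ⟨a, ha, p.concat hvw, fun u hu => ?_⟩
  rw [Walk.support_concat, List.mem_append, List.mem_singleton] at hu
  rcases hu with hu | rfl
  · exact hp u hu
  · exact hw

theorem Separates.not_reachAvoiding (h : G.Separates A B X) {v : V}
    (hA : G.ReachAvoiding A X v) (hB : G.ReachAvoiding B X v) : False := by
  obtain ⟨a, ha, p, hp⟩ := hA
  obtain ⟨b, hb, q, hq⟩ := hB
  obtain ⟨u, hu, huX⟩ := h ha hb (p.append q.reverse)
  rw [Walk.mem_support_append_iff, Walk.support_reverse, List.mem_reverse] at hu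
  exact hu.elim (fun hu => hp u hu huX) (fun hu => hq u hu huX)

theorem adj_deleteEdge_or {x y u v : V} (h : G.Adj u v) :
    (G.deleteEdges {s(x, y)}).Adj u v ∨ (u = x ∧ v = y) ∨ (u = y ∧ v = x) := by
  by_cases h' : s(u, v) = s(x, y)
  · right
    simpa using h'
  · left
    simp only [deleteEdges_adj, Set.mem_singleton_iff]
    exact ⟨h, h'⟩

/-- Follow a walk of `G` that starts in `A` and avoids `Z`. Its vertices remain reachable from `A`
in `G'` avoiding both `Z` and `S`, hence never lie in `insert x S`. The edge `xy` is never used: not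
from `x`, which is excluded, and not from `y`, which lies on the `B`-side of `S`. So the walk cannot
get to `B`. -/
theorem Separates.of_deleteEdge {x y : V} {S Z : Set V}
    (hS : (G.deleteEdges {s(x, y)}).Separates A B S)
    (hy : (G.deleteEdges {s(x, y)}).ReachAvoiding B S y)
    (hZ : (G.deleteEdges {s(x, y)}).Separates A (insert x S) Z) : G.Separates A B Z := by
  set G' := G.deleteEdges {s(x, y)}
  have notP : ∀ v, G'.ReachAvoiding A Z v → v ∉ insert x S := by
    rintro v ⟨a, ha, p, hp⟩ hv
    obtain ⟨u, hu, huZ⟩ := hZ ha hv p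
    exact hp u hu huZ
  have key : ∀ (u w : V) (p : G.Walk u w), (∀ v ∈ p.support, v ∉ Z) →
      G'.ReachAvoiding A Z u → G'.ReachAvoiding A S u →
      G'.ReachAvoiding A Z w ∧ G'.ReachAvoiding A S w := by
    intro u w p
    induction p with
    | nil => exact fun _ h1 h2 => ⟨h1, h2⟩
    | @cons u v w h p ih =>
      intro hp h1 h2
      have hpv : ∀ z ∈ p.support, z ∉ Z := fun z hz => hp z (by simp [hz])
      rcases adj_deleteEdge_or (x := x) (y := y) h with h' | ⟨rfl, rfl⟩ | ⟨rfl, rfl⟩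
      · have h3 : G'.ReachAvoiding A Z v := h1.adj h' (hpv v p.start_mem_support)
        exact ih hpv h3 (h2.adj h' fun hv => notP v h3 (Or.inr hv))
      · exact absurd (Or.inl rfl) (notP _ h1)
      · exact (hS.not_reachAvoiding h2 hy).elim
  intro a ha b hb p
  by_contra! hcon
  have h1 : G'.ReachAvoiding A Z a := .of_mem ha (hcon a p.start_mem_support)
  have h2 : G'.ReachAvoiding A S a := .of_mem ha fun h => notP a h1 (Or.inr h)
  obtain ⟨-, h3⟩ := key a b p hcon h1 h2
  exact hS.not_reachAvoiding h3 (.of_mem hb h3.notMem)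

/-- Reading the walk backwards from `w`, reachability from `B` propagates until the deleted edge is
met, and then an endpoint of that edge is reachable. This locates `x` and `y` on the two sides of
`S`. -/
theorem reachAvoiding_or_of_walk {x y : V} {S : Set V} :
    ∀ {u w : V} (p : G.Walk u w), (∀ v ∈ p.support, v ∉ S) →
      (G.deleteEdges {s(x, y)}).ReachAvoiding B S w →
      (G.deleteEdges {s(x, y)}).ReachAvoiding B S u ∨
      (G.deleteEdges {s(x, y)}).ReachAvoiding B S x ∨
      (G.deleteEdges {s(x, y)}).ReachAvoiding B S y := by
  intro u w p
  induction p with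
  | nil => exact fun _ h => Or.inl h
  | @cons u v w h p ih =>
    intro hp hw
    rcases ih (fun z hz => hp z (by simp [hz])) hw with h1 | h1
    · rcases adj_deleteEdge_or (x := x) (y := y) h with h' | ⟨rfl, rfl⟩ | ⟨rfl, rfl⟩
      · exact Or.inl (h1.adj h'.symm (hp u (by simp)))
      · exact Or.inr (Or.inr h1)
      · exact Or.inr (Or.inl h1)
    · exact Or.inr h1

theorem Separates.insert_of_deleteEdge {x y : V} {S : Set V}
    (hS : (G.deleteEdges {s(x, y)}).Separates A B S) : G.Separates A B (insert x S) := by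
  intro a ha b hb p
  by_cases hx : x ∈ p.support
  · exact ⟨x, hx, Or.inl rfl⟩
  · obtain ⟨v, hv, hvS⟩ := hS ha hb (p.toDeleteEdges {s(x, y)} (by
      rintro e he rfl
      exact hx (p.fst_mem_support_of_mem_edges he)))
    exact ⟨v, by simpa [Walk.toDeleteEdges] using hv, Or.inr hvS⟩

/-- There are pairwise disjoint `A`-`B` paths in `G` indexed by `ι`. -/
def HasDisjointPaths (G : SimpleGraph V) (A B : Set V) (ι : Type*) : Prop :=
  ∃ (a b : ι → V) (p : ∀ i, G.Walk (a i) (b i)),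
    (∀ i, a i ∈ A) ∧ (∀ i, b i ∈ B) ∧ (∀ i, (p i).IsPath) ∧
    Pairwise fun i j => ∀ v ∈ (p i).support, v ∉ (p j).support

theorem HasDisjointPaths.reindex {ι κ : Type*} (h : G.HasDisjointPaths A B ι) (f : κ → ι)
    (hf : Function.Injective f) : G.HasDisjointPaths A B κ := by
  obtain ⟨a, b, p, h1, h2, h3, h4⟩ := h
  exact ⟨a ∘ f, b ∘ f, fun i => p (f i), fun i => h1 _, fun i => h2 _, fun i => h3 _,
    fun i j hij => h4 (hf.ne hij)⟩

theorem HasDisjointPaths.symm {ι : Type*} (h : G.HasDisjointPaths A B ι) :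
    G.HasDisjointPaths B A ι := by
  obtain ⟨a, b, p, h1, h2, h3, h4⟩ := h
  exact ⟨b, a, fun i => (p i).reverse, h2, h1, fun i => (h3 i).reverse,
    fun i j hij v hv hv' => h4 hij v (by simpa using hv) (by simpa using hv')⟩

/-- Disjoint paths have distinct ends, so as many paths as `P` has vertices exhaust `P` and can be
indexed by their ends. -/
theorem HasDisjointPaths.exists_path_to {ι : Type*} [Finite ι] {P : Finset V}
    (hP : P.card = Nat.card ι) (h : G.HasDisjointPaths A P ι) :
    ∃ (a : P → V) (p : ∀ t : P, G.Walk (a t) t), (∀ t, a t ∈ A) ∧ (∀ t, (p t).IsPath) ∧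
      Pairwise fun s t => ∀ v ∈ (p s).support, v ∉ (p t).support := by
  obtain ⟨a, b, p, h1, h2, h3, h4⟩ := h
  let f : ι → P := fun i => ⟨b i, h2 i⟩
  have hf : Function.Injective f := by
    intro i j hij
    by_contra hne
    have hb : b i = b j := congrArg Subtype.val hij
    exact h4 hne (b i) (p i).end_mem_support (by rw [hb]; exact (p j).end_mem_support)
  have hbij : Function.Bijective f :=
    (Nat.bijective_iff_injective_and_card f).2 ⟨hf, by simp [← hP]⟩
  have hex : ∀ t : P, ∃ i, b i = t := fun t => by
    obtain ⟨i, hi⟩ := hbij.2 t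
    exact ⟨i, congrArg Subtype.val hi⟩
  choose g hg using hex
  refine ⟨fun t => a (g t), fun t => (p (g t)).copy rfl (hg t), fun t => h1 _,
    fun t => by simpa using h3 _, fun s t hst v hv hv' => ?_⟩
  refine h4 (i := g s) (j := g t) (fun e => hst (Subtype.ext ?_)) v (by simpa using hv)
    (by simpa using hv')
  rw [← hg s, ← hg t, e]

/-- The two path systems are glued at the common ends in `S`, and the path ending in `x` is glued to
the one ending in `y` through the edge `xy`. -/
theorem HasDisjointPaths.of_deleteEdge {x y : V} {S : Finset V} {ι : Type*} [Finite ι]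
    (hxy : G.Adj x y) (hx : x ∉ S) (hy : y ∉ S) (hcard : S.card + 1 = Nat.card ι)
    (hS : (G.deleteEdges {s(x, y)}).Separates A B S)
    (hA : (G.deleteEdges {s(x, y)}).HasDisjointPaths A (insert x (S : Set V)) ι)
    (hB : (G.deleteEdges {s(x, y)}).HasDisjointPaths B (insert y (S : Set V)) ι) :
    G.HasDisjointPaths A B ι := by
  classical
  set G' := G.deleteEdges {s(x, y)}
  have hle : G' ≤ G := deleteEdges_le _
  have hPc : (insert x S).card = Nat.card ι := by rw [Finset.card_insert_of_notMem hx, hcard]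
  have hQc : (insert y S).card = Nat.card ι := by rw [Finset.card_insert_of_notMem hy, hcard]
  rw [← Finset.coe_insert] at hA hB
  obtain ⟨a, p, ha, hp, hpd⟩ := hA.exists_path_to hPc
  obtain ⟨b, q, hb, hq, hqd⟩ := hB.exists_path_to hQc
  -- By disjointness, a path of either system meets `S` at most in its own end. If `p s` and `q t`
  -- met outside `S`, their initial parts up to that vertex would form an `A`-`B` walk of `G'`
  -- missing `S`.
  have cross : ∀ s t v, v ∈ (p s).support → v ∈ (q t).support → v ∈ S ∧ v = s ∧ v = t := by
    intro s t v hv hv'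
    have hps : ∀ z, z ∈ S → z ∈ (p s).support → z = s := by
      intro z hz hz'
      by_contra hne
      exact hpd (i := s) (j := ⟨z, Finset.mem_insert_of_mem hz⟩)
        (fun e => hne (congrArg Subtype.val e).symm) z hz' (Walk.end_mem_support _)
    have hqt : ∀ z, z ∈ S → z ∈ (q t).support → z = t := by
      intro z hz hz'
      by_contra hne
      exact hqd (i := t) (j := ⟨z, Finset.mem_insert_of_mem hz⟩)
        (fun e => hne (congrArg Subtype.val e).symm) z hz' (Walk.end_mem_support _)
    suffices hvS : v ∈ S from ⟨hvS, hps v hvS hv, hqt v hvS hv'⟩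
    obtain ⟨z, hz, hzS⟩ := hS (ha s) (hb t)
      (((p s).takeUntil v hv).append ((q t).takeUntil v hv').reverse)
    rw [Walk.mem_support_append_iff, Walk.support_reverse, List.mem_reverse] at hz
    rcases hz with hz | hz
    · have hzs := hps z hzS ((p s).support_takeUntil_subset_support hv hz)
      by_contra hvS
      have hne : v ≠ s := fun e => hvS (by rw [e, ← hzs]; exact hzS)
      exact Walk.endpoint_notMem_support_takeUntil (hp s) hv hne.symm (hzs ▸ hz)
    · have hzt := hqt z hzS ((q t).support_takeUntil_subset_support hv' hz)
      by_contra hvS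
      have hne : v ≠ t := fun e => hvS (by rw [e, ← hzt]; exact hzS)
      exact Walk.endpoint_notMem_support_takeUntil (hq t) hv' hne.symm (hzt ▸ hz)
  let f : ↥(insert x S) → ↥(insert y S) := fun t =>
    if h : t.1 ∈ S then ⟨t.1, Finset.mem_insert_of_mem h⟩ else ⟨y, Finset.mem_insert_self y S⟩
  have hfS : ∀ t, t.1 ∈ S → (f t).1 = t.1 := fun t h => by simp [f, h]
  have hfx : ∀ t, t.1 ∉ S → t.1 = x ∧ (f t).1 = y := fun t h =>
    ⟨(Finset.mem_insert.1 t.2).resolve_right h, by simp [f, h]⟩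
  have hfinj : Function.Injective f := by
    intro s t hst
    have hst' : (f s).1 = (f t).1 := congrArg Subtype.val hst
    by_cases h1 : s.1 ∈ S <;> by_cases h2 : t.1 ∈ S
    · rw [hfS s h1, hfS t h2] at hst'
      exact Subtype.ext hst'
    · rw [hfS s h1, (hfx t h2).2] at hst'
      exact absurd (hst' ▸ h1) hy
    · rw [hfS t h2, (hfx s h1).2] at hst'
      exact absurd (hst' ▸ h2) hy
    · exact Subtype.ext ((hfx s h1).1.trans (hfx t h2).1.symm)
  have hr : ∀ t, ∃ r : G.Walk (a t) (b (f t)), r.IsPath ∧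
      ∀ v ∈ r.support, v ∈ (p t).support ∨ v ∈ (q (f t)).support := by
    intro t
    suffices h : ∃ r : G.Walk (a t) (b (f t)),
        ∀ v ∈ r.support, v ∈ (p t).support ∨ v ∈ (q (f t)).support by
      obtain ⟨r, hr⟩ := h
      exact ⟨r.bypass, r.bypass_isPath, fun v hv => hr v (r.support_bypass_subset_support hv)⟩
    by_cases h : t.1 ∈ S
    · refine ⟨((p t).mapLe hle).append
        (((q (f t)).mapLe hle).reverse.copy (hfS t h) rfl), fun v hv => ?_⟩
      rw [Walk.mem_support_append_iff] at hv
      simpa using hv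
    · have hadj : G.Adj t (f t) := by
        rw [(hfx t h).2, (hfx t h).1]
        exact hxy
      refine ⟨((p t).mapLe hle).append (.cons hadj ((q (f t)).mapLe hle).reverse),
        fun v hv => ?_⟩
      rw [Walk.mem_support_append_iff, Walk.support_cons, List.mem_cons] at hv
      rcases hv with hv | rfl | hv
      · exact Or.inl (by simpa using hv)
      · exact Or.inl (Walk.end_mem_support _)
      · exact Or.inr (by simpa using hv)
  choose r hr hrs using hr
  have hfin : G.HasDisjointPaths A B ↥(insert x S) := by
    refine ⟨a, fun t => b (f t), r, ha, fun t => hb _, hr, fun s t hst v hv hv' => ?_⟩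
    have mixed : ∀ s t, s ≠ t → v ∈ (p s).support → v ∈ (q (f t)).support → False := by
      intro s t hst h1 h2
      obtain ⟨hvS, e1, e2⟩ := cross _ _ v h1 h2
      by_cases h : t.1 ∈ S
      · exact hst (Subtype.ext (by rw [← e1, e2, hfS t h]))
      · rw [(hfx t h).2] at e2
        exact hy (e2 ▸ hvS)
    rcases hrs s v hv with h1 | h1 <;> rcases hrs t v hv' with h2 | h2
    · exact hpd hst v h1 h2
    · exact mixed s t hst h1 h2
    · exact mixed t s hst.symm h2 h1
    · exact hqd (hfinj.ne hst) v h1 h2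
  have e : ι ≃ ↥(insert x S) :=
    (Finite.equivFinOfCardEq hPc.symm).trans (Finset.equivFinOfCardEq rfl).symm
  exact hfin.reindex e e.injective

/-- **Menger's theorem** for graphs with finitely many edges. -/
theorem hasDisjointPaths_of_forall_separates (hG : G.edgeSet.Finite) (hA : A.Finite) {k : ℕ}
    (h : ∀ X : Finset V, G.Separates A B X → k ≤ X.card) :
    G.HasDisjointPaths A B (Fin k) := by
  classical
  induction hn : G.edgeSet.ncard using Nat.strong_induction_on generalizing G A B with
  | _ n ih =>
  by_cases hE : G = ⊥
  · subst hE
    have hAB : (A ∩ B).Finite := hA.inter_of_left B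
    have hk : k ≤ hAB.toFinset.card := by
      refine h _ fun a ha b hb p => ?_
      cases p with
      | nil => exact ⟨a, by simp, by simp [ha, hb]⟩
      | cons h _ => exact h.elim
    obtain ⟨Y, hY, hYc⟩ := Finset.exists_subset_card_eq hk
    let e : Fin k ≃ Y := (Finset.equivFinOfCardEq hYc).symm
    have hmem : ∀ i, (e i).1 ∈ A ∩ B := fun i => hAB.mem_toFinset.1 (hY (e i).2)
    refine ⟨fun i => e i, fun i => e i, fun i => .nil, fun i => (hmem i).1, fun i => (hmem i).2,
      fun i => .nil, fun i j hij v hv hv' => ?_⟩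
    simp only [Walk.support_nil, List.mem_singleton] at hv hv'
    exact hij (e.injective (Subtype.ext (hv.symm.trans hv')))
  obtain ⟨x, y, hxy⟩ : ∃ x y, G.Adj x y := by
    by_contra! hcon
    exact hE (by ext u v; simp [hcon u v])
  have hfin' : (G.deleteEdges {s(x, y)}).edgeSet.Finite :=
    hG.subset (edgeSet_mono (deleteEdges_le _))
  have hlt : (G.deleteEdges {s(x, y)}).edgeSet.ncard < n := by
    rw [← hn, edgeSet_deleteEdges]
    exact Set.ncard_sdiff_singleton_lt_of_mem hxy hG
  by_cases hS : ∀ X : Finset V, (G.deleteEdges {s(x, y)}).Separates A B X → k ≤ X.card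
  · obtain ⟨a, b, p, h1, h2, h3, h4⟩ := ih _ hlt hfin' hA hS rfl
    exact ⟨a, b, fun i => (p i).mapLe (deleteEdges_le _), h1, h2,
      fun i => (h3 i).mapLe _, fun i j hij v hv hv' => h4 hij v (by simpa using hv)
        (by simpa using hv')⟩
  push Not at hS
  obtain ⟨S, hS, hSk⟩ := hS
  -- Since `insert x S` separates in `G` and `S` has fewer than `k` vertices, `S` has exactly `k -
  -- 1`. By `Separates.of_deleteEdge`, separators of `A` from `insert x S` or of `insert y S` from
  -- `B` in the smaller graph also separate `A` from `B` in `G`, so induction yields `k` paths on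
  -- each side.
  have step : ∀ x y : V, G.Adj x y → (G.deleteEdges {s(x, y)}).edgeSet.ncard < n →
      (G.deleteEdges {s(x, y)}).edgeSet.Finite →
      (G.deleteEdges {s(x, y)}).Separates A B S →
      (G.deleteEdges {s(x, y)}).ReachAvoiding A S x →
      (G.deleteEdges {s(x, y)}).ReachAvoiding B S y → G.HasDisjointPaths A B (Fin k) := by
    intro x y hxy hlt hfin hS hx hy
    have hsw : G.deleteEdges {s(y, x)} = G.deleteEdges {s(x, y)} := by rw [Sym2.eq_swap]
    have hxS : x ∉ S := by simpa using hx.notMem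
    have hyS : y ∉ S := by simpa using hy.notMem
    have hk : k ≤ (insert x S).card := h _ (by
      rw [Finset.coe_insert]
      exact hS.insert_of_deleteEdge)
    rw [Finset.card_insert_of_notMem hxS] at hk
    refine HasDisjointPaths.of_deleteEdge hxy hxS hyS (by simp; omega) hS
      (ih _ hlt hfin hA (fun Z hZ => h Z (hS.of_deleteEdge hy hZ)) rfl) ?_
    refine (ih _ hlt hfin (A := insert y (S : Set V)) (B := B)
      ((Finset.finite_toSet S).insert y) (fun Z hZ => h Z ?_) rfl).symm
    exact (Separates.of_deleteEdge (x := y) (y := x) (hsw ▸ hS.symm) (hsw ▸ hx)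
      (hsw ▸ hZ.symm)).symm
  -- As `S` is too small to separate in `G`, some walk avoids it. That walk must use `xy`, and
  -- tracing it from both ends shows that one endpoint lies on the `A`-side and the other on the
  -- `B`-side.
  obtain ⟨a, ha, b, hb, p, hp⟩ : ∃ a ∈ A, ∃ b ∈ B, ∃ p : G.Walk a b, ∀ v ∈ p.support, v ∉ S := by
    by_contra! hcon
    have := h S fun a ha b hb p => hcon a ha b hb p
    omega
  have h1a : (G.deleteEdges {s(x, y)}).ReachAvoiding A S a :=
    .of_mem ha (by simpa using hp a p.start_mem_support)
  have h1b : (G.deleteEdges {s(x, y)}).ReachAvoiding B S b :=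
    .of_mem hb (by simpa using hp b p.end_mem_support)
  have h2 := (reachAvoiding_or_of_walk p (by simpa using hp) h1b).resolve_left
    fun hc => hS.not_reachAvoiding h1a hc
  have h3 := (reachAvoiding_or_of_walk p.reverse (by simpa using hp) h1a).resolve_left
    fun hc => hS.not_reachAvoiding hc h1b
  have hsw : G.deleteEdges {s(y, x)} = G.deleteEdges {s(x, y)} := by rw [Sym2.eq_swap]
  rcases h3 with h3 | h3 <;> rcases h2 with h2 | h2
  · exact (hS.not_reachAvoiding h3 h2).elim
  · exact step x y hxy hlt hfin' hS h3 h2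
  · exact step y x hxy.symm (hsw ▸ hlt) (hsw ▸ hfin') (hsw ▸ hS) (hsw ▸ h3) (hsw ▸ h2)
  · exact (hS.not_reachAvoiding h3 h2).elim

end SimpleGraph

/-! ### Minors from branch sets -/

namespace PebblyEnds

variable {V : Type*} {W : Type*}

/-- Disjoint connected sets may have superfluous edges between them. The subgraph keeps every edge
inside a set and one chosen edge for each edge of `G`. -/
theorem isMinor_of_branchSets {G : SimpleGraph W} {Γ : SimpleGraph V} (A : W → Set V)
    (hconn : ∀ w, (Γ.induce (A w)).Connected) (hdisj : Pairwise fun v w => Disjoint (A v) (A w))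
    (hadj : ∀ v w, G.Adj v w → ∃ x ∈ A v, ∃ y ∈ A w, Γ.Adj x y) : IsMinor G Γ := by
  classical
  have huniq : ∀ {v w x}, x ∈ A v → x ∈ A w → v = w := fun {v w x} hv hw => by
    by_contra hne
    exact Set.disjoint_left.1 (hdisj hne) hv hw
  -- Choosing over unordered pairs makes the choice for `vw` and for `wv` the same edge.
  have hex : ∀ e : Sym2 W, ∃ f : Sym2 V, ∀ v w, e = s(v, w) → G.Adj v w →
      ∃ x ∈ A v, ∃ y ∈ A w, Γ.Adj x y ∧ f = s(x, y) := by
    intro e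
    induction e using Sym2.ind with
    | _ v w =>
    by_cases h : G.Adj v w
    · obtain ⟨x, hx, y, hy, hxy⟩ := hadj v w h
      refine ⟨s(x, y), fun v' w' he _ => ?_⟩
      rcases Sym2.eq_iff.1 he with ⟨rfl, rfl⟩ | ⟨rfl, rfl⟩
      · exact ⟨x, hx, y, hy, hxy, rfl⟩
      · exact ⟨y, hy, x, hx, hxy.symm, Sym2.eq_swap⟩
    · by_cases hV : Nonempty V
      · obtain ⟨z⟩ := hV
        refine ⟨s(z, z), fun v' w' he h' => (h ?_).elim⟩
        rcases Sym2.eq_iff.1 he with ⟨rfl, rfl⟩ | ⟨rfl, rfl⟩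
        · exact h'
        · exact h'.symm
      · exact (hV ⟨((hconn v).nonempty.some : A v).1⟩).elim
  choose g hg using hex
  let H : Γ.Subgraph :=
    { verts := ⋃ w, A w
      Adj := fun x y => Γ.Adj x y ∧ ∃ v w, x ∈ A v ∧ y ∈ A w ∧
        (v = w ∨ (G.Adj v w ∧ g s(v, w) = s(x, y)))
      adj_sub := fun h => h.1
      edge_vert := by
        rintro x y ⟨-, v, w, hx, -⟩
        exact Set.mem_iUnion.2 ⟨v, hx⟩
      symm := ⟨by
        rintro x y ⟨h, v, w, hx, hy, h'⟩
        refine ⟨h.symm, w, v, hy, hx, h'.imp Eq.symm fun h'' => ⟨h''.1.symm, ?_⟩⟩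
        rw [Sym2.eq_swap, h''.2, Sym2.eq_swap]⟩ }
  have hφ : ∀ x : H.verts, ∃ w, x.1 ∈ A w := fun x => Set.mem_iUnion.1 x.2
  choose φ hφ using hφ
  have hφe : ∀ x v, φ x = v ↔ x.1 ∈ A v :=
    fun x v => ⟨fun h => h ▸ hφ x, fun h => huniq (hφ x) h⟩
  have hmem : ∀ {x v}, x ∈ A v → x ∈ H.verts := fun {x v} h => Set.mem_iUnion.2 ⟨v, h⟩
  have hcross : ∀ {v w x y}, v ≠ w → x ∈ A v → y ∈ A w → H.Adj x y →
      G.Adj v w ∧ g s(v, w) = s(x, y) := by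
    rintro v w x y hvw hx hy ⟨-, v', w', hx', hy', h⟩
    obtain rfl := huniq hx hx'
    obtain rfl := huniq hy hy'
    exact h.resolve_left hvw
  refine ⟨H, φ, fun v => ?_, fun v w hvw => ⟨?_, fun h => ?_⟩, ?_⟩
  · let f : Γ.induce (A v) →g H.coe.induce (φ ⁻¹' {v}) :=
      { toFun := fun x => ⟨⟨x.1, hmem x.2⟩, (hφe _ _).2 x.2⟩
        map_rel' := fun {x y} h => ⟨h, v, v, x.2, y.2, Or.inl rfl⟩ }
    refine (hconn v).map f ?_
    rintro ⟨x, hx⟩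
    exact ⟨⟨x.1, (hφe _ _).1 hx⟩, rfl⟩
  · rintro ⟨x, y, hx, hy, h⟩
    exact (hcross hvw ((hφe _ _).1 hx) ((hφe _ _).1 hy) h).1
  · obtain ⟨x, hx, y, hy, hxy, he⟩ := hg s(v, w) v w rfl h
    exact ⟨⟨x, hmem hx⟩, ⟨y, hmem hy⟩, (hφe _ _).2 hx, (hφe _ _).2 hy, hxy, v, w, hx, hy,
      Or.inr ⟨h, he⟩⟩
  · intro v w hvw x y x' y' hx hy h hx' hy' h'
    rw [hφe] at hx hy hx' hy'
    have e := (hcross hvw hx hy h).2.symm.trans (hcross hvw hx' hy' h').2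
    rcases Sym2.eq_iff.1 e with ⟨e1, e2⟩ | ⟨e1, e2⟩
    · exact ⟨Subtype.ext e1, Subtype.ext e2⟩
    · exact (hvw (huniq hx (e1 ▸ hy'))).elim

/-! ### Segments of rays and connectors between rays -/

variable {Γ : SimpleGraph V} {n k : ℕ}

/-- The vertices of the ray `R` with index between `a` and `b`. -/
def Ray.seg (R : Ray Γ) (a b : ℕ) : Set V := R.vert '' Set.Icc a b

theorem Ray.seg_finite (R : Ray Γ) (a b : ℕ) : (R.seg a b).Finite :=
  (Set.finite_Icc a b).image _

theorem Ray.mem_seg {R : Ray Γ} {a b i : ℕ} (ha : a ≤ i) (hb : i ≤ b) : R.vert i ∈ R.seg a b :=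
  ⟨i, ⟨ha, hb⟩, rfl⟩

theorem induce_singleton_connected (v : V) : (Γ.induce {v}).Connected := by
  simp

theorem Ray.seg_connected (R : Ray Γ) {a b : ℕ} (h : a ≤ b) :
    (Γ.induce (R.seg a b)).Connected := by
  induction b, h using Nat.le_induction with
  | base =>
    rw [Ray.seg, Set.Icc_self, Set.image_singleton]
    exact induce_singleton_connected _
  | succ b h ih =>
    have e : R.seg a (b + 1) = R.seg a b ∪ {R.vert (b + 1)} := by
      rw [Ray.seg, Ray.seg, ← Set.image_singleton, ← Set.image_union]
      congr 1
      ext i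
      simp only [Set.mem_Icc, Set.mem_union, Set.mem_singleton_iff]
      omega
    rw [e]
    exact SimpleGraph.connected_induce_union ih.preconnected
      (induce_singleton_connected _).preconnected (R.mem_seg h le_rfl) rfl (R.adj b)

theorem DisjointRays.eq_of_vert_eq {ι : Type*} {R : ι → Ray Γ} (hR : DisjointRays R) {i j : ι}
    {s t : ℕ} (h : (R i).vert s = (R j).vert t) : i = j ∧ s = t := by
  have hij : i = j := by
    by_contra hne
    exact Set.disjoint_left.1 (hR hne) ⟨s, rfl⟩ ⟨t, h.symm⟩
  subst hij
  exact ⟨rfl, (R i).inj h⟩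

/-- Pigeonhole on the first `Y.card + 1` paths. The bound on `m` depends only on the size of `Y`,
which `InfDisjointPaths.exists_finite` exploits. -/
theorem exists_avoiding_of_pairwise_disjoint {a b : ℕ → V} (P : ∀ n, Γ.Walk (a n) (b n))
    (hP : Pairwise fun m n => ∀ v ∈ (P m).support, v ∉ (P n).support) (Y : Finset V) :
    ∃ m ≤ Y.card, ∀ v ∈ (P m).support, v ∉ Y := by
  by_contra! hcon
  have hcon' : ∀ m, ∃ v, m ≤ Y.card → v ∈ (P m).support ∧ v ∈ Y := fun m => by
    by_cases h : m ≤ Y.card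
    · exact (hcon m h).imp fun v hv _ => hv
    · exact ⟨a 0, fun h' => (h h').elim⟩
  choose f hf using hcon'
  have hcard : Y.card < (Finset.range (Y.card + 1)).card := by simp
  obtain ⟨i, hi, j, hj, hij, he⟩ := Finset.exists_ne_map_eq_of_card_lt_of_maps_to hcard
    (fun m hm => (hf m (by simpa [Nat.lt_succ_iff] using hm)).2)
  have hi' := (hf i (by simpa [Nat.lt_succ_iff] using hi)).1
  have hj' := (hf j (by simpa [Nat.lt_succ_iff] using hj)).1
  exact hP hij _ hi' (he ▸ hj')

theorem exists_walk_to_adj_end {b a : V} (p : Γ.Walk b a) (hp : p.IsPath) (hne : a ≠ b) :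
    ∃ (c : V) (q : Γ.Walk a c), Γ.Adj c b ∧ b ∉ q.support ∧ ∀ v ∈ q.support, v ∈ p.support := by
  cases p with
  | nil => exact (hne rfl).elim
  | cons h q =>
    rw [SimpleGraph.Walk.cons_isPath_iff] at hp
    exact ⟨_, q.reverse, h.symm, by simpa using hp.2, fun v hv => by simp_all⟩

/-- Adjacent rays of the ray graph are joined by a connected finite set arbitrarily far out,
which contains exactly one vertex of the rays of the family. -/
theorem exists_connector {R : Fin n → Ray Γ} (hR : DisjointRays R) {u v : Fin n}
    (huv : (rayGraph R).Adj u v) {X : Set V} (hX : X.Finite) (T : ℕ) :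
    ∃ (a b : ℕ) (Q : Set V), T < a ∧ T < b ∧ Q.Finite ∧ (Γ.induce Q).Connected ∧
      (R u).vert a ∈ Q ∧ (∃ q ∈ Q, Γ.Adj q ((R v).vert b)) ∧ Disjoint Q X ∧
      ∀ j t, (R j).vert t ∈ Q → (R j).vert t = (R u).vert a := by
  classical
  obtain ⟨huv, α, β, P, h1, h2, h3⟩ := huv
  -- Excluding the initial segments of both rays forces the ends of the path beyond index `T`.
  let Y : Finset V := (hX.union (((R u).seg_finite 0 T).union ((R v).seg_finite 0 T))).toFinset
  obtain ⟨m, -, hm⟩ := exists_avoiding_of_pairwise_disjoint P h3 Y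
  have hY : ∀ w ∈ (P m).support, w ∉ X ∧ w ∉ (R u).seg 0 T ∧ w ∉ (R v).seg 0 T := by
    intro w hw
    have := hm w hw
    simp only [Y, Set.Finite.mem_toFinset, Set.mem_union, not_or] at this
    exact this
  obtain ⟨a, ha⟩ := ((h1 m).mem_left _ (P m).start_mem_support).2 rfl
  obtain ⟨b, hb⟩ := ((h1 m).mem_right _ (P m).end_mem_support).2 rfl
  have haT : T < a := by
    by_contra! hle
    exact (hY _ (P m).start_mem_support).2.1 (ha ▸ Ray.mem_seg a.zero_le hle)
  have hbT : T < b := by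
    by_contra! hle
    exact (hY _ (P m).end_mem_support).2.2 (hb ▸ Ray.mem_seg b.zero_le hle)
  have hab : α m ≠ β m := by
    rw [← ha, ← hb]
    exact fun h => huv (hR.eq_of_vert_eq h).1
  -- Removing the end on `R v` leaves a set that meets the whole family only in `(R u).vert a`.
  obtain ⟨c, q, hc, hbq, hq⟩ := exists_walk_to_adj_end (P m).reverse (h1 m).isPath.reverse hab
  refine ⟨a, b, {w | w ∈ q.support}, haT, hbT, q.support.finite_toSet,
    q.connected_induce_support, ?_, ⟨c, q.end_mem_support, by rwa [hb]⟩, ?_, fun j t ht => ?_⟩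
  · rw [ha]
    exact q.start_mem_support
  · exact Set.disjoint_left.2 fun w hw => (hY w (by simpa using hq w hw)).1
  · have ht' : (R j).vert t ∈ (P m).support := by simpa using hq _ ht
    rw [ha]
    by_cases hj : j = u
    · subst hj
      exact ((h1 m).mem_left _ ht').1 ⟨t, rfl⟩
    · by_cases hj' : j = v
      · subst hj'
        exact absurd ht (((h1 m).mem_right _ ht').1 ⟨t, rfl⟩ ▸ hbq)
      · exact absurd ⟨j, hj, hj', t, rfl⟩ (h2 m _ ht')

end PebblyEnds

namespace PebblyEnds

variable {V : Type*} {Γ : SimpleGraph V} {n k : ℕ}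

/-! ### Pebbling along a family of rays -/

/-- Disjoint finite connected sets `B i`, the `i`-th of which reaches the ray `R (σ i)` at its
vertex of index `T`, and which avoid all later vertices of the rays. -/
structure PebbleConfig (R : Fin n → Ray Γ) (σ : GameState (Fin n) k) (T : ℕ)
    (B : Fin k → Set V) : Prop where
  finite : ∀ i, (B i).Finite
  connected : ∀ i, (Γ.induce (B i)).Connected
  disjoint : Pairwise fun i j => Disjoint (B i) (B j)
  tip : ∀ i, (R (σ i)).vert T ∈ B i
  avoid : ∀ i j t, T < t → (R j).vert t ∉ B i

variable {R : Fin n → Ray Γ} {σ σ' : GameState (Fin n) k} {T T' : ℕ} {B : Fin k → Set V}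

theorem PebbleConfig.advance (hR : DisjointRays R) (h : PebbleConfig R σ T B) (hT : T ≤ T') :
    PebbleConfig R σ T' fun i => B i ∪ (R (σ i)).seg T T' := by
  have aux : ∀ i j, i ≠ j → Disjoint (B i) ((R (σ j)).seg T T') := by
    intro i j hij
    rw [Set.disjoint_right]
    rintro _ ⟨t, ⟨ht, -⟩, rfl⟩ hB
    -- Index `T` is not covered by `avoid`, but that vertex already belongs to `B j`.
    rcases ht.eq_or_lt with rfl | ht
    · exact Set.disjoint_left.1 (h.disjoint hij) hB (h.tip j)
    · exact h.avoid _ _ _ ht hB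
  refine ⟨fun i => (h.finite i).union (Ray.seg_finite _ _ _), fun i => ?_, fun i j hij => ?_,
    fun i => Or.inr (Ray.mem_seg hT le_rfl), fun i j t ht => ?_⟩
  · exact SimpleGraph.induce_union_connected (h.connected i).preconnected
      ((R (σ i)).seg_connected hT).preconnected ⟨_, h.tip i, Ray.mem_seg le_rfl hT⟩
  · beta_reduce
    rw [Set.disjoint_union_left, Set.disjoint_union_right, Set.disjoint_union_right]
    refine ⟨⟨h.disjoint hij, aux i j hij⟩, (aux j i hij.symm).symm, ?_⟩
    exact (hR (σ.injective.ne hij)).mono (Set.image_subset_range _ _) (Set.image_subset_range _ _)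
  · rintro (hB | ⟨s, ⟨-, hs⟩, he⟩)
    · exact h.avoid i j t (hT.trans_lt ht) hB
    · have := (hR.eq_of_vert_eq he).2
      omega

theorem PebbleConfig.attach (h : PebbleConfig R σ T B) (l : Fin k) {Q : Set V} (hfin : Q.Finite)
    (hconn : (Γ.induce Q).Connected) (hmeet : (B l ∩ Q).Nonempty)
    (hdisj : ∀ i, i ≠ l → Disjoint (B i) Q) (havoid : ∀ j t, T < t → (R j).vert t ∉ Q) :
    PebbleConfig R σ T (Function.update B l (B l ∪ Q)) := by
  refine ⟨fun i => ?_, fun i => ?_, fun i j hij => ?_, fun i => ?_, fun i j t ht => ?_⟩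
  · rcases eq_or_ne i l with rfl | hi
    · simpa using ⟨h.finite i, hfin⟩
    · simpa [hi] using h.finite i
  · rcases eq_or_ne i l with rfl | hi
    · rw [Function.update_self]
      exact SimpleGraph.induce_union_connected (h.connected i).preconnected hconn.preconnected
        hmeet
    · rw [Function.update_of_ne hi]
      exact h.connected i
  · rcases eq_or_ne i l with rfl | hi
    · simpa [hij.symm] using ⟨h.disjoint hij, (hdisj j hij.symm).symm⟩
    · rcases eq_or_ne j l with rfl | hj
      · simpa [hi] using ⟨h.disjoint hij, hdisj i hij⟩
      · simpa [hi, hj] using h.disjoint hij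
  · rcases eq_or_ne i l with rfl | hi
    · simpa using Or.inl (h.tip i)
    · simpa [hi] using h.tip i
  · rcases eq_or_ne i l with rfl | hi
    · simpa using ⟨h.avoid i j t ht, havoid j t ht⟩
    · simpa [hi] using h.avoid i j t ht

theorem subset_update_union (B : Fin k → Set V) (l : Fin k) (Q : Set V) (i : Fin k) :
    B i ⊆ Function.update B l (B l ∪ Q) i := by
  rcases eq_or_ne i l with rfl | hi
  · simp
  · simp [hi]

/-- All sets advance along their rays to a common index beyond the connector. The moving set also
absorbs the connector and the part of the target ray from `b` on, which no other set occupies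
because `σ'` is injective. The vacated ray is free again beyond the new index. -/
theorem PebbleConfig.move (hR : DisjointRays R) (h : PebbleConfig R σ T B)
    (hm : IsMove (rayGraph R) σ σ') :
    ∃ T' B', PebbleConfig R σ' T' B' ∧ ∀ i, B i ⊆ B' i := by
  obtain ⟨l, hl, hne⟩ := hm
  obtain ⟨a, b, Q, ha, hb, hQf, hQc, haQ, ⟨q, hq, hqb⟩, hQX, hQR⟩ :=
    exists_connector hR hl (Set.finite_iUnion h.finite) T
  have haT : a ≤ max a b := le_max_left _ _
  have hbT : b ≤ max a b := le_max_right _ _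
  have h1 := h.advance hR (T' := max a b) (by omega)
  have h2 := h1.attach l (Q := Q ∪ (R (σ' l)).seg b (max a b))
    (hQf.union (Ray.seg_finite _ _ _))
    (SimpleGraph.connected_induce_union hQc.preconnected
      (Ray.seg_connected _ hbT).preconnected hq (Ray.mem_seg le_rfl hbT) hqb)
    ⟨_, Or.inr (Ray.mem_seg ha.le haT), Or.inl haQ⟩ (fun i hi => ?_) (fun j t ht => ?_)
  · refine ⟨max a b, _, ⟨h2.finite, h2.connected, h2.disjoint, fun i => ?_, h2.avoid⟩, fun i => ?_⟩
    · by_cases hi : i = l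
      · subst hi
        rw [Function.update_self]
        exact Or.inr (Or.inr (Ray.mem_seg hbT le_rfl))
      · rw [← hne i hi]
        exact h2.tip i
    · exact Set.subset_union_left.trans (subset_update_union (fun i => B i ∪ _) l _ i)
  · rw [Set.disjoint_union_left, Set.disjoint_union_right, Set.disjoint_union_right]
    refine ⟨⟨hQX.symm.mono_left (Set.subset_iUnion B i), ?_⟩, ?_, ?_⟩
    · rw [Set.disjoint_right]
      rintro _ ⟨t, ⟨ht, -⟩, rfl⟩
      exact h.avoid _ _ _ (hb.trans_le ht)
    · rw [Set.disjoint_left]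
      rintro _ ⟨t, -, rfl⟩ ht
      exact hi (σ.injective (hR.eq_of_vert_eq (hQR _ _ ht)).1)
    · rw [hne i hi]
      exact (hR (σ'.injective.ne hi)).mono (Set.image_subset_range _ _)
        (Set.image_subset_range _ _)
  · rintro (hQ | ⟨s, ⟨-, hs⟩, he⟩)
    · have := (hR.eq_of_vert_eq (hQR _ _ hQ)).2
      omega
    · have := (hR.eq_of_vert_eq he).2
      omega

theorem PebbleConfig.play (hR : DisjointRays R) (h : PebbleConfig R σ T B)
    (hm : Achievable (rayGraph R) σ σ') :
    ∃ T' B', PebbleConfig R σ' T' B' ∧ ∀ i, B i ⊆ B' i := by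
  induction hm with
  | refl => exact ⟨T, B, h, fun _ => subset_rfl⟩
  | tail _ hm ih =>
    obtain ⟨T₁, B₁, h₁, hB₁⟩ := ih
    obtain ⟨T₂, B₂, h₂, hB₂⟩ := h₁.move hR hm
    exact ⟨T₂, B₂, h₂, fun i => (hB₁ i).trans (hB₂ i)⟩

/-- The set `l` absorbs the connector, while the set `m` advances past the vertex of its ray next to
the connector's far end. -/
theorem PebbleConfig.link (hR : DisjointRays R) (h : PebbleConfig R σ T B) {l m : Fin k}
    (hlm : (rayGraph R).Adj (σ l) (σ m)) :
    ∃ T' B', PebbleConfig R σ T' B' ∧ (∀ i, B i ⊆ B' i) ∧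
      ∃ x ∈ B' m, ∃ y ∈ B' l, Γ.Adj x y := by
  obtain ⟨a, b, Q, ha, hb, hQf, hQc, haQ, ⟨q, hq, hqb⟩, hQX, hQR⟩ :=
    exists_connector hR hlm (Set.finite_iUnion h.finite) T
  have haT : a ≤ max a b := le_max_left _ _
  have hbT : b ≤ max a b := le_max_right _ _
  have h1 := h.advance hR (T' := max a b) (by omega)
  have h2 := h1.attach l hQf hQc ⟨_, Or.inr (Ray.mem_seg ha.le haT), haQ⟩ (fun i hi => ?_)
    (fun j t ht hQ => ?_)
  · refine ⟨max a b, _, h2, fun i => ?_, (R (σ m)).vert b, ?_, q, ?_, hqb.symm⟩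
    · exact Set.subset_union_left.trans (subset_update_union (fun i => B i ∪ _) l _ i)
    · exact subset_update_union (fun i => B i ∪ _) l _ m (Or.inr (Ray.mem_seg hb.le hbT))
    · rw [Function.update_self]
      exact Or.inr hq
  · rw [Set.disjoint_union_left]
    refine ⟨hQX.symm.mono_left (Set.subset_iUnion B i), ?_⟩
    rw [Set.disjoint_left]
    rintro _ ⟨t, -, rfl⟩ ht
    exact hi (σ.injective (hR.eq_of_vert_eq (hQR _ _ ht)).1)
  · have := (hR.eq_of_vert_eq (hQR _ _ hQ)).2
    omega

theorem exists_gameState_eq {W : Type*} (σ : GameState W k) {l m : Fin k} {u v : W} (hlm : l ≠ m)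
    (huv : u ≠ v) : ∃ τ : GameState W k, τ l = u ∧ τ m = v := by
  classical
  let e := Equiv.swap (σ l) u
  have hne : e (σ m) ≠ u := fun h => hlm (σ.injective (e.injective (by
    rw [h, Equiv.swap_apply_left])))
  -- The first transposition sends pebble `l` to `u`. The second sends pebble `m` to `v` and fixes
  -- `u` by `hne` and `huv`.
  refine ⟨(σ.trans e.toEmbedding).trans (Equiv.swap (e (σ m)) v).toEmbedding, ?_, ?_⟩
  · simp only [Function.Embedding.trans_apply, Equiv.coe_toEmbedding]
    rw [show e (σ l) = u from Equiv.swap_apply_left _ _, Equiv.swap_apply_of_ne_of_ne hne.symm huv]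
  · simp

/-- A state with pebble `l` at the position of pebble `m` differs from `σ`, so reaching it takes a
first move, which runs along an edge. -/
theorem PebbleWin.exists_adj {W : Type*} {G : SimpleGraph W} (hG : PebbleWin G k)
    (σ : GameState W k) {l m : Fin k} (hlm : l ≠ m) : ∃ u v, G.Adj u v := by
  obtain ⟨τ, hτ, -⟩ := exists_gameState_eq σ hlm (σ.injective.ne hlm.symm)
  rcases Relation.ReflTransGen.cases_head (hG σ τ) with rfl | ⟨_, ⟨i, hi, -⟩, -⟩
  · exact (hlm (σ.injective hτ)).elim
  · exact ⟨_, _, hi⟩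

/-- In a pebble-win ray graph, one of the sets of a configuration can be joined to any of the
others by an edge, after enlarging the sets. -/
theorem PebbleConfig.link_all (hR : DisjointRays R) (hwin : PebbleWin (rayGraph R) k)
    (h : PebbleConfig R σ T B) (l : Fin k) (I : Finset (Fin k)) (hI : l ∉ I) :
    ∃ σ' T' B', PebbleConfig (k := k) R σ' T' B' ∧ (∀ i, B i ⊆ B' i) ∧
      ∀ i ∈ I, ∃ x ∈ B' i, ∃ y ∈ B' l, Γ.Adj x y := by
  classical
  induction I using Finset.induction_on with
  | empty => exact ⟨σ, T, B, h, fun _ => subset_rfl, by simp⟩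
  | insert m I _ ih =>
    obtain ⟨σ₁, T₁, B₁, h₁, hB₁, hadj⟩ := ih fun hl => hI (Finset.mem_insert_of_mem hl)
    have hlm : l ≠ m := fun e => hI (e ▸ Finset.mem_insert_self m I)
    -- Any edge of the ray graph will do: the game is played until `l` and `m` occupy its two ends.
    obtain ⟨u, v, huv⟩ := hwin.exists_adj σ₁ hlm
    obtain ⟨τ, rfl, rfl⟩ := exists_gameState_eq σ₁ hlm huv.ne
    obtain ⟨T₂, B₂, h₂, hB₂⟩ := h₁.play hR (hwin σ₁ τ)
    obtain ⟨T₃, B₃, h₃, hB₃, hxy⟩ := h₂.link hR huv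
    refine ⟨τ, T₃, B₃, h₃, fun i => (hB₁ i).trans ((hB₂ i).trans (hB₃ i)), fun i hi => ?_⟩
    rcases Finset.mem_insert.1 hi with rfl | hi
    · exact hxy
    · obtain ⟨x, hx, y, hy, hxy⟩ := hadj i hi
      exact ⟨x, hB₃ _ (hB₂ _ hx), y, hB₃ _ (hB₂ _ hy), hxy⟩

/-- A new pebble can be put on an unoccupied ray. -/
theorem PebbleConfig.exists_snoc (hR : DisjointRays R) (h : PebbleConfig R σ T B) (hk : k < n) :
    ∃ (σ' : GameState (Fin n) (k + 1)) (T' : ℕ) (B' : Fin (k + 1) → Set V),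
      PebbleConfig R σ' T' B' ∧ ∀ i, B i ⊆ B' i.castSucc := by
  obtain ⟨j, hj⟩ : ∃ j, j ∉ Set.range σ := by
    by_contra! hcon
    have := Fintype.card_le_of_surjective σ fun j => hcon j
    simp at this
    omega
  -- On the free ray the vertex of index `T` may lie in some `B i`; the one of index `T + 1` cannot,
  -- and starts the new set.
  have h1 := h.advance hR (T' := T + 1) (by omega)
  have hnew : ∀ i, (R j).vert (T + 1) ∉ B i ∪ (R (σ i)).seg T (T + 1) := by
    rintro i (hB | ⟨s, -, hs⟩)
    · exact h.avoid i j _ (by omega) hB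
    · exact hj ⟨i, (hR.eq_of_vert_eq hs).1⟩
  refine ⟨Fin.Embedding.snoc σ hj, T + 1,
    Fin.snoc (fun i => B i ∪ (R (σ i)).seg T (T + 1)) {(R j).vert (T + 1)},
    ⟨fun i => ?_, fun i => ?_, fun i i' hij => ?_, fun i => ?_, fun i j' t ht => ?_⟩, fun i => ?_⟩
  · induction i using Fin.lastCases with
    | last => simp
    | cast i => simpa only [Fin.snoc_castSucc] using h1.finite i
  · induction i using Fin.lastCases with
    | last =>
      rw [Fin.snoc_last]
      exact induce_singleton_connected _
    | cast i =>
      rw [Fin.snoc_castSucc]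
      exact h1.connected i
  · induction i using Fin.lastCases with
    | last =>
      induction i' using Fin.lastCases with
      | last => exact (hij rfl).elim
      | cast i' => simpa only [Fin.snoc_castSucc, Fin.snoc_last, Set.disjoint_singleton_left]
          using hnew i'
    | cast i =>
      induction i' using Fin.lastCases with
      | last => simpa only [Fin.snoc_castSucc, Fin.snoc_last, Set.disjoint_singleton_right]
          using hnew i
      | cast i' =>
        simpa only [Fin.snoc_castSucc] using h1.disjoint fun e => hij (congrArg Fin.castSucc e)
  · induction i using Fin.lastCases with
    | last => simp
    | cast i => simpa only [Fin.snoc_castSucc, Fin.Embedding.snoc_castSucc] using h1.tip i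
  · induction i using Fin.lastCases with
    | last =>
      rw [Fin.snoc_last, Set.mem_singleton_iff]
      intro he
      have := (hR.eq_of_vert_eq he).2
      omega
    | cast i => simpa only [Fin.snoc_castSucc] using h1.avoid i j' t ht
  · rw [Fin.snoc_castSucc]
    exact Set.subset_union_left

end PebblyEnds

namespace PebblyEnds

variable {V : Type*} {Γ : SimpleGraph V} {n k : ℕ}

/-! ### Linking families of rays of the same end -/

/-- The edges of `Γ` inside `F`, as a graph on all vertices. -/
def restrictTo (Γ : SimpleGraph V) (F : Set V) : SimpleGraph V where
  Adj u v := Γ.Adj u v ∧ u ∈ F ∧ v ∈ F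
  symm := ⟨fun _ _ h => ⟨h.1.symm, h.2.2, h.2.1⟩⟩
  loopless := ⟨fun _ h => Γ.irrefl h.1⟩

theorem restrictTo_le (Γ : SimpleGraph V) (F : Set V) : restrictTo Γ F ≤ Γ := fun _ _ h => h.1

theorem restrictTo_edgeSet_finite (Γ : SimpleGraph V) {F : Set V} (hF : F.Finite) :
    (restrictTo Γ F).edgeSet.Finite := by
  refine ((hF.prod hF).image fun p => s(p.1, p.2)).subset fun e he => ?_
  induction e using Sym2.ind with
  | _ u v => exact ⟨(u, v), ⟨he.2.1, he.2.2⟩, rfl⟩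

theorem support_subset_of_restrictTo {F : Set V} {u w : V} (p : (restrictTo Γ F).Walk u w)
    (hu : u ∈ F) : ∀ v ∈ p.support, v ∈ F := by
  induction p with
  | nil => simpa using hu
  | cons h p ih => simpa using ⟨hu, ih h.2.2⟩

theorem exists_walk_restrictTo {F : Set V} {u w : V} (p : Γ.Walk u w)
    (hp : ∀ v ∈ p.support, v ∈ F) :
    ∃ q : (restrictTo Γ F).Walk u w, q.support = p.support := by
  induction p with
  | nil => exact ⟨.nil, rfl⟩
  | cons h p ih =>
    obtain ⟨q, hq⟩ := ih fun v hv => hp v (by simp [hv])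
    have hadj : (restrictTo Γ F).Adj _ _ := ⟨h, hp _ (by simp), hp _ (by simp)⟩
    exact ⟨.cons hadj q, by simp [hq]⟩

theorem Ray.exists_walk_seg (R : Ray Γ) {a b : ℕ} (h : a ≤ b) :
    ∃ p : Γ.Walk (R.vert a) (R.vert b), ∀ v ∈ p.support, v ∈ R.seg a b := by
  induction b, h using Nat.le_induction with
  | base => exact ⟨.nil, by simp [Ray.seg]⟩
  | succ b h ih =>
    obtain ⟨p, hp⟩ := ih
    refine ⟨p.concat (R.adj b), fun v hv => ?_⟩
    rw [SimpleGraph.Walk.support_concat, List.mem_append, List.mem_singleton] at hv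
    rcases hv with hv | rfl
    · obtain ⟨i, ⟨h1, h2⟩, rfl⟩ := hp v hv
      exact R.mem_seg h1 (by omega)
    · exact R.mem_seg (by omega) le_rfl

theorem exists_index_bound (R : Fin n → Ray Γ) {X : Set V} (hX : X.Finite) :
    ∃ N, ∀ j t, N ≤ t → (R j).vert t ∉ X := by
  have hfin : (⋃ j, (R j).vert ⁻¹' X).Finite :=
    Set.finite_iUnion fun j => hX.preimage (R j).inj.injOn
  obtain ⟨N, hN⟩ := hfin.bddAbove
  refine ⟨N + 1, fun j t ht hX => ?_⟩
  have : t ≤ N := hN (Set.mem_iUnion.2 ⟨j, hX⟩)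
  omega

theorem DisjointRays.exists_avoiding {R : Fin n → Ray Γ} (hR : DisjointRays R) (X : Finset V)
    (hX : X.card < n) : ∃ j, ∀ t, (R j).vert t ∉ X := by
  by_contra! hcon
  choose t ht using hcon
  obtain ⟨i, -, j, -, hij, he⟩ := Finset.exists_ne_map_eq_of_card_lt_of_maps_to
    (s := Finset.univ) (t := X) (by simpa using hX) (fun j _ => ht j)
  exact hij (hR.eq_of_vert_eq he).1

/-- Take `F` to be the union of `N + 1` of the paths. It is fixed before `Y`, so one finite region
serves against all small separators. -/
theorem InfDisjointPaths.exists_finite {A B Z : Set V} (h : InfDisjointPaths Γ A B Z) (N : ℕ) :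
    ∃ F : Set V, F.Finite ∧ ∀ Y : Finset V, Y.card ≤ N →
      ∃ a ∈ A, ∃ b ∈ B, ∃ p : Γ.Walk a b, ∀ v ∈ p.support, v ∈ F ∧ v ∉ Y := by
  obtain ⟨a, b, P, h1, -, h3⟩ := h
  refine ⟨⋃ m ∈ Set.Iic N, {v | v ∈ (P m).support},
    (Set.finite_Iic N).biUnion fun m _ => (P m).support.finite_toSet, fun Y hY => ?_⟩
  obtain ⟨m, hm, hmY⟩ := exists_avoiding_of_pairwise_disjoint P h3 Y
  exact ⟨a m, ((h1 m).mem_left _ (P m).start_mem_support).2 rfl, b m,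
    ((h1 m).mem_right _ (P m).end_mem_support).2 rfl, P m,
    fun v hv => ⟨Set.mem_biUnion (hm.trans hY) hv, hmY v hv⟩⟩

/-- The initial vertices of `k` disjoint rays can be linked by disjoint finite connected sets to
vertices of at least `k` further disjoint rays of the same end. -/
theorem exists_linkage {S : Fin k → Ray Γ} {R : Fin n → Ray Γ} (hS : DisjointRays S)
    (hR : DisjointRays R) (hSR : ∀ i j, RayEquiv (S i) (R j)) (hkn : k ≤ n) {U : Set V}
    (hU : U.Finite) (hSU : ∀ i t, 0 < t → (S i).vert t ∉ U) :
    ∃ (T : ℕ) (σ : GameState (Fin n) k) (C : Fin k → Set V),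
      (∀ i, (C i).Finite) ∧ (∀ i, (Γ.induce (C i)).Connected) ∧
      (Pairwise fun i j => Disjoint (C i) (C j)) ∧ (∀ i, (S i).vert 0 ∈ C i) ∧
      (∀ i, (R (σ i)).vert T ∈ C i) ∧ (∀ i, ∀ v ∈ C i, v ∈ U → ∃ l, v = (S l).vert 0) ∧
      (∀ i j t, T < t → (R j).vert t ∉ C i ∪ U) := by
  classical
  obtain ⟨t₀, ht₀⟩ := exists_index_bound R hU
  have hX : (U ∪ ⋃ j, (R j).seg 0 t₀).Finite :=
    hU.union (Set.finite_iUnion fun j => Ray.seg_finite _ _ _)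
  -- The allowance `k` is for a separator in Menger's theorem; the rest keeps the path away from `U`
  -- and from the first vertices of the rays `R j`.
  choose F hF hFp using fun i j =>
    InfDisjointPaths.exists_finite (hSR i j) (k + hX.toFinset.card)
  have hFF : (⋃ i, ⋃ j, F i j).Finite :=
    Set.finite_iUnion fun i => Set.finite_iUnion fun j => hF i j
  obtain ⟨L, hL⟩ := exists_index_bound S hFF
  set D : Set V := (⋃ i, ⋃ j, F i j) ∪ ⋃ i, (S i).seg 0 L with hD
  have hDfin : D.Finite := hFF.union (Set.finite_iUnion fun i => Ray.seg_finite _ _ _)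
  obtain ⟨T₁, hT₁⟩ := exists_index_bound R hDfin
  set T := max t₀ T₁
  have ht₀T : t₀ ≤ T := le_max_left _ _
  have hT₁T : T₁ ≤ T := le_max_right _ _
  -- This is the finite region for Menger's theorem. It contains no vertex of `U` except possibly
  -- starts of the rays `S l`, since the rays `R j` have left `U` by index `t₀`.
  set F₀ : Set V := {v ∈ D | v ∈ U → ∃ l, v = (S l).vert 0} ∪ ⋃ j, (R j).seg t₀ T with hF₀
  have hF₀fin : F₀.Finite :=
    (hDfin.subset (Set.sep_subset _ _)).union (Set.finite_iUnion fun j => Ray.seg_finite _ _ _)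
  have hstart : ∀ i, (S i).vert 0 ∈ F₀ := fun i =>
    Or.inl ⟨Or.inr (Set.mem_iUnion.2 ⟨i, Ray.mem_seg le_rfl L.zero_le⟩), fun _ => ⟨i, rfl⟩⟩
  -- Fewer than `k` vertices miss entirely some `S i` and some `R j`. Following `S i`, a connecting
  -- path in `F i j`, and then `R j` up to index `T` gives a walk inside `F₀` that avoids them.
  have hsep : ∀ X : Finset V, (restrictTo Γ F₀).Separates
      (Set.range fun i => (S i).vert 0) (Set.range fun j => (R j).vert T) X → k ≤ X.card := by
    intro X hXsep
    by_contra! hXk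
    obtain ⟨i, hi⟩ := hS.exists_avoiding X hXk
    obtain ⟨j, hj⟩ := hR.exists_avoiding X (hXk.trans_le hkn)
    obtain ⟨_, ⟨c, rfl⟩, _, ⟨d, rfl⟩, p, hp⟩ := hFp i j (X ∪ hX.toFinset)
      ((Finset.card_union_le _ _).trans (by omega))
    have hpF : ∀ v ∈ p.support, v ∈ ⋃ i, ⋃ j, F i j := fun v hv =>
      Set.mem_iUnion₂.2 ⟨i, j, (hp v hv).1⟩
    have hpX : ∀ v ∈ p.support, v ∉ X ∧ v ∉ U ∧ ∀ l, v ∉ (R l).seg 0 t₀ := fun v hv => by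
      simpa using (hp v hv).2
    have hcL : c < L := by
      by_contra! hle
      exact hL i c hle (hpF _ p.start_mem_support)
    have hdt : t₀ < d := by
      by_contra! hle
      exact (hpX _ p.end_mem_support).2.2 j (Ray.mem_seg d.zero_le hle)
    have hdT : d < T₁ := by
      by_contra! hle
      exact hT₁ j d hle (Or.inl (hpF _ p.end_mem_support))
    obtain ⟨q, hq⟩ := (S i).exists_walk_seg c.zero_le
    obtain ⟨r, hr⟩ := (R j).exists_walk_seg (hdT.le.trans hT₁T)
    have hw : ∀ v ∈ ((q.append p).append r).support, v ∈ F₀ ∧ v ∉ X := by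
      intro v hv
      rw [SimpleGraph.Walk.mem_support_append_iff, SimpleGraph.Walk.mem_support_append_iff] at hv
      rcases hv with (hv | hv) | hv
      · obtain ⟨s, ⟨-, hs⟩, rfl⟩ := hq v hv
        refine ⟨Or.inl ⟨Or.inr (Set.mem_iUnion.2 ⟨i, Ray.mem_seg s.zero_le (by omega)⟩),
          fun hsU => ⟨i, ?_⟩⟩, hi s⟩
        rcases s.eq_zero_or_pos with rfl | hs0
        · rfl
        · exact (hSU i s hs0 hsU).elim
      · exact ⟨Or.inl ⟨Or.inl (hpF v hv), fun h => ((hpX v hv).2.1 h).elim⟩, (hpX v hv).1⟩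
      · obtain ⟨s, ⟨hs, hs'⟩, rfl⟩ := hr v hv
        exact ⟨Or.inr (Set.mem_iUnion.2 ⟨j, Ray.mem_seg (by omega) hs'⟩), hj s⟩
    obtain ⟨w, hws⟩ := exists_walk_restrictTo _ fun v hv => (hw v hv).1
    obtain ⟨v, hv, hvX⟩ := hXsep ⟨i, rfl⟩ ⟨j, rfl⟩ w
    exact (hw v (hws ▸ hv)).2 hvX
  obtain ⟨a, b, p, ha, hb, -, hp⟩ := SimpleGraph.hasDisjointPaths_of_forall_separates
    (restrictTo_edgeSet_finite Γ hF₀fin) (Set.finite_range _) hsep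
  choose f hf using ha
  choose τ hτ using hb
  beta_reduce at hf hτ
  have hf_inj : Function.Injective f := by
    intro i j hij
    by_contra hne
    refine hp hne (a i) (p i).start_mem_support ?_
    rw [← hf i, hij, hf j]
    exact (p j).start_mem_support
  have hτ_inj : Function.Injective τ := by
    intro i j hij
    by_contra hne
    refine hp hne (b i) (p i).end_mem_support ?_
    rw [← hτ i, hij, hτ j]
    exact (p j).end_mem_support
  -- Menger's paths come in arbitrary order, so they are relabelled by the ray whose start they
  -- contain.
  let e : Fin k ≃ Fin k := Equiv.ofBijective f (Finite.injective_iff_bijective.1 hf_inj)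
  have he : ∀ i, f (e.symm i) = i := fun i => e.apply_symm_apply i
  have hsub : ∀ i, ∀ v ∈ (p i).support, v ∈ F₀ := fun i =>
    support_subset_of_restrictTo (p i) (hf i ▸ hstart _)
  refine ⟨T, ⟨fun i => τ (e.symm i), hτ_inj.comp e.symm.injective⟩,
    fun i => {v | v ∈ (p (e.symm i)).support}, fun i => List.finite_toSet _, fun i => ?_,
    fun i j hij => ?_, fun i => ?_, fun i => ?_, fun i v hv hvU => ?_, fun i j t ht => ?_⟩
  · have := ((p (e.symm i)).mapLe (restrictTo_le Γ F₀)).connected_induce_support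
    rwa [SimpleGraph.Walk.support_mapLe_eq_support] at this
  · exact Set.disjoint_left.2 (hp (e.symm.injective.ne hij))
  · have := hf (e.symm i)
    rw [he] at this
    rw [this]
    exact (p (e.symm i)).start_mem_support
  · exact (hτ (e.symm i)).symm ▸ (p (e.symm i)).end_mem_support
  · rcases hsub _ v hv with h | h
    · exact h.2 hvU
    · obtain ⟨j, s, ⟨hs, -⟩, rfl⟩ := Set.mem_iUnion.1 h
      exact (ht₀ j s hs hvU).elim
  · rintro (h | h)
    · rcases hsub _ _ h with h | h
      · exact hT₁ j t (hT₁T.trans ht.le) h.1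
      · obtain ⟨j', s, ⟨-, hs⟩, he⟩ := Set.mem_iUnion.1 h
        have := (hR.eq_of_vert_eq he).2
        omega
    · exact ht₀ j t (ht₀T.trans ht.le) h

/-! ### The construction -/

/-- The ray obtained by deleting the first `T` vertices. -/
def Ray.tail (R : Ray Γ) (T : ℕ) : Ray Γ where
  vert t := R.vert (T + t)
  inj _ _ h := Nat.add_left_cancel (R.inj h)
  adj t := R.adj (T + t)

theorem Ray.tail_rayEquiv (R : Ray Γ) (T : ℕ) : RayEquiv (R.tail T) R := by
  refine ⟨(R.tail T).vert, (R.tail T).vert, fun _ => .nil, fun t => ⟨.nil, ?_, ?_⟩, ?_, ?_⟩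
  · simp [Ray.verts]
  · simp [Ray.verts, Ray.tail]
  · simp
  · intro s t hst v hv hv'
    simp only [SimpleGraph.Walk.support_nil, List.mem_singleton] at hv hv'
    exact hst ((R.tail T).inj (hv.symm.trans hv'))

theorem Ray.TendsTo.tail {R : Ray Γ} {ω : GraphEnd Γ} (h : R.TendsTo ω) (T : ℕ) :
    (R.tail T).TendsTo ω :=
  (Quotient.sound (R.tail_rayEquiv T)).trans h

/-- The sets `B i` are finite branch sets of a complete minor, from which disjoint rays `S i`
of the end `ω` start. -/
structure IsRootedClique (ω : GraphEnd Γ) (B : Fin k → Set V) (S : Fin k → Ray Γ) : Prop where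
  finite : ∀ i, (B i).Finite
  connected : ∀ i, (Γ.induce (B i)).Connected
  disjoint : Pairwise fun i j => Disjoint (B i) (B j)
  adj : ∀ i j, i ≠ j → ∃ x ∈ B i, ∃ y ∈ B j, Γ.Adj x y
  rays_disjoint : DisjointRays S
  tendsTo : ∀ i, (S i).TendsTo ω
  start : ∀ i, (S i).vert 0 ∈ B i
  avoid : ∀ i j t, 0 < t → (S j).vert t ∉ B i

variable {ω : GraphEnd Γ} {B : Fin k → Set V} {S : Fin k → Ray Γ}

/-- Each `B i` is enlarged by its linking set `C i`. The linking sets meet the old sets only in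
starts of rays, and the start of `S l` lies in `C l`, so `C i` and `B j` are disjoint for `i ≠ j`.
-/
theorem IsRootedClique.exists_pebbleConfig (h : IsRootedClique ω B S) {R : Fin n → Ray Γ}
    (hR : DisjointRays R) (hRω : ∀ j, (R j).TendsTo ω) (hkn : k ≤ n) :
    ∃ σ T B', PebbleConfig (k := k) R σ T B' ∧ ∀ i, B i ⊆ B' i := by
  obtain ⟨T, σ, C, hCf, hCc, hCd, hSC, hRC, hCU, hav⟩ := exists_linkage h.rays_disjoint hR
    (fun i j => Quotient.exact ((h.tendsTo i).trans (hRω j).symm)) hkn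
    (Set.finite_iUnion h.finite) (fun i t ht hU => by
      obtain ⟨j, hj⟩ := Set.mem_iUnion.1 hU
      exact h.avoid j i t ht hj)
  have aux : ∀ i j, i ≠ j → Disjoint (C i) (B j) := by
    intro i j hij
    rw [Set.disjoint_left]
    intro v hv hvB
    obtain ⟨l, rfl⟩ := hCU i v hv (Set.mem_iUnion.2 ⟨j, hvB⟩)
    have hlj : l = j := by
      by_contra hne
      exact Set.disjoint_left.1 (h.disjoint hne) (h.start l) hvB
    subst hlj
    exact Set.disjoint_left.1 (hCd hij) hv (hSC l)
  refine ⟨σ, T, fun i => B i ∪ C i, ⟨fun i => (h.finite i).union (hCf i), fun i => ?_,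
    fun i j hij => ?_, fun i => Or.inr (hRC i), fun i j t ht => ?_⟩,
    fun i => Set.subset_union_left⟩
  · exact SimpleGraph.induce_union_connected (h.connected i).preconnected (hCc i).preconnected
      ⟨_, h.start i, hSC i⟩
  · beta_reduce
    rw [Set.disjoint_union_left, Set.disjoint_union_right, Set.disjoint_union_right]
    exact ⟨⟨h.disjoint hij, (aux j i hij.symm).symm⟩, aux i j hij, hCd hij⟩
  · rintro (hB | hC)
    · exact hav i j t ht (Or.inr (Set.mem_iUnion.2 ⟨i, hB⟩))
    · exact hav i j t ht (Or.inl hC)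

/-- Asking for `k + 1` pebbles guarantees a free ray for the new set. The rays `S` serve only to
lead to the family `R`, whose tails at the final pebble positions become the new rays. -/
theorem IsRootedClique.exists_succ (hω : IsPebbly ω) (h : IsRootedClique ω B S) :
    ∃ (B' : Fin (k + 1) → Set V) (S' : Fin (k + 1) → Ray Γ),
      IsRootedClique ω B' S' ∧ ∀ i, B i ⊆ B' i.castSucc := by
  obtain ⟨n, hkn, R, hR, hRω, hwin⟩ := hω (k + 1)
  obtain ⟨σ₀, T₀, B₀, h₀, hB₀⟩ := h.exists_pebbleConfig hR hRω (by omega)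
  obtain ⟨σ₁, T₁, B₁, h₁, hB₁⟩ := h₀.exists_snoc hR hkn
  obtain ⟨σ, T, B₂, h₂, hB₂, hadj⟩ := h₁.link_all hR hwin (Fin.last k)
    (Finset.univ.erase (Fin.last k)) (by simp)
  have hsub : ∀ i, B i ⊆ B₂ i.castSucc := fun i => (hB₀ i).trans ((hB₁ i).trans (hB₂ _))
  refine ⟨B₂, fun i => (R (σ i)).tail T, ⟨h₂.finite, h₂.connected, h₂.disjoint, fun i j hij => ?_,
    fun i j hij => ?_, fun i => (hRω _).tail T, fun i => h₂.tip i,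
    fun i j t ht => h₂.avoid i _ _ (by omega)⟩, hsub⟩
  · induction j using Fin.lastCases with
    | last => exact hadj i (by simp [hij])
    | cast j =>
      induction i using Fin.lastCases with
      | last =>
        obtain ⟨x, hx, y, hy, hxy⟩ := hadj j.castSucc (by simp)
        exact ⟨y, hy, x, hx, hxy.symm⟩
      | cast i =>
        obtain ⟨x, hx, y, hy, hxy⟩ := h.adj i j fun e => hij (congrArg Fin.castSucc e)
        exact ⟨x, hsub i hx, y, hsub j hy, hxy⟩
  · exact Set.disjoint_left.2 fun v ⟨s, hs⟩ ⟨t, ht⟩ =>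
      hij (σ.injective (hR.eq_of_vert_eq (hs.trans ht.symm)).1)

/-- A graph with a pebbly end has infinitely many pairwise adjacent disjoint branch sets. -/
theorem IsPebbly.exists_branchSets (hω : IsPebbly ω) :
    ∃ A : ℕ → Set V, (∀ i, (Γ.induce (A i)).Connected) ∧
      (Pairwise fun i j => Disjoint (A i) (A j)) ∧
      ∀ i j, i ≠ j → ∃ x ∈ A i, ∃ y ∈ A j, Γ.Adj x y := by
  -- The rays are only asserted to exist, because successive stages are compatible in their sets
  -- alone.
  let State : ℕ → Type _ := fun k => {B : Fin k → Set V // ∃ S, IsRootedClique ω B S}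
  have hstep : ∀ k (s : State k), ∃ s' : State (k + 1), ∀ i, s.1 i ⊆ s'.1 i.castSucc := by
    rintro k ⟨B, S, h⟩
    obtain ⟨B', S', h', hB⟩ := h.exists_succ hω
    exact ⟨⟨B', S', h'⟩, hB⟩
  choose next hnext using hstep
  let s₀ : State 0 := ⟨fun i => i.elim0, fun i => i.elim0,
    ⟨fun i => i.elim0, fun i => i.elim0, fun i => i.elim0, fun i => i.elim0, fun i => i.elim0,
      fun i => i.elim0, fun i => i.elim0, fun i => i.elim0⟩⟩
  let s : ∀ k, State k := fun k => Nat.rec s₀ next k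
  -- The `i`-th set at stage `N` is taken to be empty until it is born, which makes it monotone in
  -- `N`.
  let D : ℕ → ℕ → Set V := fun i N => {v | ∃ h : i < N, v ∈ (s N).1 ⟨i, h⟩}
  have hDmono : ∀ i, Monotone (D i) := fun i =>
    monotone_nat_of_le_succ fun N v ⟨h, hv⟩ => ⟨h.trans N.lt_succ_self, hnext _ (s N) _ hv⟩
  have hD : ∀ i N (h : i < N), D i N = (s N).1 ⟨i, h⟩ := fun i N h =>
    Set.ext fun v => ⟨fun hv => hv.2, fun hv => ⟨h, hv⟩⟩
  have hDconn : ∀ i N, i < N → (Γ.induce (D i N)).Connected := fun i N h => by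
    obtain ⟨S, hS⟩ := (s N).2
    rw [hD i N h]
    exact hS.connected _
  refine ⟨fun i => ⋃ N, D i N, fun i => ?_, fun i j hij => ?_, fun i j hij => ?_⟩
  · obtain ⟨u, hu⟩ := (hDconn i (i + 1) i.lt_succ_self).nonempty.some
    -- Every vertex of the union shares some finite, connected stage with the fixed vertex `u`.
    refine SimpleGraph.induce_connected_of_patches (G := Γ) u
      (Set.mem_iUnion.2 ⟨i + 1, hu⟩) fun {v} hv => ?_
    obtain ⟨N, hN⟩ := Set.mem_iUnion.1 hv
    exact ⟨D i (max N (i + 1)), Set.subset_iUnion _ _, hDmono i (le_max_right _ _) hu,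
      hDmono i (le_max_left _ _) hN, (hDconn i _ (by omega)).preconnected _ _⟩
  · refine Set.disjoint_left.2 fun v hv hv' => ?_
    obtain ⟨N, hN⟩ := Set.mem_iUnion.1 hv
    obtain ⟨N', hN'⟩ := Set.mem_iUnion.1 hv'
    obtain ⟨hi, h1⟩ := hDmono i (le_max_left N N') hN
    obtain ⟨hj, h2⟩ := hDmono j (le_max_right N N') hN'
    obtain ⟨S, h⟩ := (s (max N N')).2
    exact Set.disjoint_left.1 (h.disjoint fun e => hij (congrArg Fin.val e)) h1 h2
  · obtain ⟨S, h⟩ := (s (i + j + 1)).2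
    have hi : i < i + j + 1 := by omega
    have hj : j < i + j + 1 := by omega
    obtain ⟨x, hx, y, hy, hxy⟩ := h.adj ⟨i, hi⟩ ⟨j, hj⟩ fun e => hij (congrArg Fin.val e)
    exact ⟨x, Set.mem_iUnion.2 ⟨_, hi, hx⟩, y, Set.mem_iUnion.2 ⟨_, hj, hy⟩, hxy⟩

end PebblyEnds

theorem mainTheorem7 {V : Type*} (Γ : SimpleGraph V) (ω : PebblyEnds.GraphEnd Γ)
    (hω : PebblyEnds.IsPebbly ω) :
    PebblyEnds.IsMinor (⊤ : SimpleGraph ℕ) Γ ∧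
    ∀ {W : Type*} [Countable W] (G : SimpleGraph W),
      PebblyEnds.IsMinor (PebblyEnds.alephZeroCopies G) Γ := by
  obtain ⟨A, hconn, hdisj, hadj⟩ := hω.exists_branchSets
  refine ⟨PebblyEnds.isMinor_of_branchSets A hconn hdisj fun i j h => hadj i j h, ?_⟩
  intro W _ G
  -- Assign distinct branch sets to the countably many vertices; surplus adjacencies are discarded
  -- by `isMinor_of_branchSets`.
  obtain ⟨f, hf⟩ := exists_injective_nat (ℕ × W)
  exact PebblyEnds.isMinor_of_branchSets (fun w => A (f w)) (fun w => hconn _)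
    (fun v w hvw => hdisj (hf.ne hvw)) fun v w h => hadj _ _ (hf.ne h.ne)
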